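/- **Online Slot Allocation (OSA).** An instance $(f,c)$ consists of $n$ items with a frequency vector $f\in\mathbb{R}_{\ge 0}^n$, $f\neq 0$, and $n$ slots with costs $0\le c(1)\le c(2)\le\cdots\le c(n)$. Requests for items are drawn i.i.d. from the normalized distribution $f/\sum_i f_i$. Whenever the requested item $i$ has not been requested before, the algorithm must irrevocably assign it to some vacant slot $j_i$, at cost $f_i\,c(j_i)$. A (randomized) algorithm is given by a distribution on the vacant slots for each tuple $(f,c,(i_1,\dots,i_t),g,i)$, where $i_1,\dots,i_t$ are the requests so far, $g$ is the injective assignment of slots to the items requested so far, and $i\notin\{i_1,\dots,i_t\}$ is the requested item that needs a slot. The algorithm is *online* if this distribution is determined by $(c,(i_1,\dots,i_t),g,i)$, i.e. does not depend on $f$. The cost of an algorithm on $(f,c)$ is the expected total assignment cost (items that are never requested cost nothing); the optimal offline cost is $\mathrm{OPT}(f,c)=\min_\sigma\sum_i f_i\,c(\sigma(i))$ over permutations $\sigma$ of $[n]=\{1,\dots,n\}$. The competitive ratio of an algorithm on a class $X$ of instances is the supremum in $[0,\infty]$, over $(f,c)\in X$, of its cost on $(f,c)$ divided by $\mathrm{OPT}(f,c)$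 (with $0/0=0$ and $x/0=\infty$ for $x>0$). *First-Come-First-Served* (FCFS) puts the $j$-th distinct item requested in slot $j$ (in an arbitrary state: it uses the vacant slot of least index). **Theorem.** Let $X$ be any class of OSA instances (possibly of different sizes $n$) that is closed under permutation of the frequency vector: whenever $(f,c)\in X$ and $\pi$ is a permutation of $[n]$, also $(f',c)\in X$, where $f'(i)=f(\pi(i))$. Then FCFS is an online algorithm, and its competitive ratio on $X$ is at most that of every (randomized) online algorithm; that is, FCFS attains the minimum competitive ratio on $X$ among all online algorithms. -/

import Mathlib

open scoped NNReal ENNReal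

noncomputable section

namespace OSA

/-- An instance of Online Slot Allocation with `n` items and `n` slots: a frequency vector `f`
(sampled from after normalization) and slot costs `c(1) ≤ ⋯ ≤ c(n)`. Items of frequency zero are
allowed; they are never requested and incur no cost. -/
structure Instance (n : ℕ) where
  /-- frequencies of the items -/
  f : Fin n → ℝ≥0
  /-- costs of the slots -/
  c : Fin n → ℝ≥0
  f_ne_zero : f ≠ 0
  c_mono : Monotone c

namespace Instance

variable {n : ℕ}

/-- The instance `(f', c)` with `f' i = f (π i)`. -/
def permute (I : Instance n) (π : Equiv.Perm (Fin n)) : Instance n where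
  f := fun i => I.f (π i)
  c := I.c
  f_ne_zero := by
    intro h
    apply I.f_ne_zero
    funext i
    simpa using congrFun h (π.symm i)
  c_mono := I.c_mono

theorem tsum_f_ne_zero (I : Instance n) : (∑' i, (I.f i : ℝ≥0∞)) ≠ 0 := by
  intro h
  apply I.f_ne_zero
  funext i
  simpa using ENNReal.tsum_eq_zero.1 h i

theorem tsum_f_ne_top (I : Instance n) : (∑' i, (I.f i : ℝ≥0∞)) ≠ ∞ := by
  rw [tsum_fintype]
  exact ENNReal.sum_ne_top.2 fun i _ => ENNReal.coe_ne_top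

/-- The law of a single request: the normalized frequency vector. -/
def requestDist (I : Instance n) : PMF (Fin n) :=
  PMF.normalize (fun i => (I.f i : ℝ≥0∞)) I.tsum_f_ne_zero I.tsum_f_ne_top

/-- The optimal offline cost: the least cost of placing the items in distinct slots. -/
def opt (I : Instance n) : ℝ≥0∞ :=
  ⨅ σ : Equiv.Perm (Fin n), ∑ i, (I.f i : ℝ≥0∞) * (I.c (σ i) : ℝ≥0∞)

end Instance

/-- A position between two requests: the requests `i₁, …, i_t` so far (in order, with repeats) and
the injective assignment of slots to exactly the requested items. -/
@[ext]
structure Position (n : ℕ) where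
  /-- the requests so far -/
  requests : List (Fin n)
  /-- the slot of each requested item -/
  assign : Fin n → Option (Fin n)
  assigned_iff : ∀ i, (∃ j, assign i = some j) ↔ i ∈ requests
  assign_inj : ∀ i i' j, assign i = some j → assign i' = some j → i = i'

namespace Position

variable {n : ℕ}

/-- The slots that hold no item. -/
abbrev Vacant (P : Position n) : Type :=
  {j : Fin n // ∀ i, P.assign i ≠ some j}

/-- The position before the first request. -/
def start (n : ℕ) : Position n where
  requests := []
  assign := fun _ => none
  assigned_iff := by simp
  assign_inj := by simp

/-- The position after a request for an item that was requested before. -/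
def again (P : Position n) (i : Fin n) (hi : i ∈ P.requests) : Position n where
  requests := P.requests ++ [i]
  assign := P.assign
  assigned_iff := by
    intro k
    rw [P.assigned_iff k]
    constructor
    · intro h
      simp [h]
    · intro h
      rcases List.mem_append.1 h with h | h
      · exact h
      · rw [List.mem_singleton.1 h]
        exact hi
  assign_inj := P.assign_inj

/-- The position after a first request for the item `i`, which is put in the vacant slot `j`. -/
def place (P : Position n) (i : Fin n) (hi : i ∉ P.requests) (j : P.Vacant) : Position n where
  requests := P.requests ++ [i]
  assign := Function.update P.assign i (some j.1)
  assigned_iff := by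
    intro k
    by_cases hk : k = i
    · subst hk
      simp
    · simp [hk, P.assigned_iff k]
  assign_inj := by
    intro k k' l hk hk'
    by_cases h : k = i <;> by_cases h' : k' = i
    · rw [h, h']
    · subst h
      rw [Function.update_self] at hk
      rw [Function.update_of_ne h'] at hk'
      exact absurd (hk'.trans hk.symm) (j.2 k')
    · subst h'
      rw [Function.update_self] at hk'
      rw [Function.update_of_ne h] at hk
      exact absurd (hk.trans hk'.symm) (j.2 k)
    · rw [Function.update_of_ne h] at hk
      rw [Function.update_of_ne h'] at hk'
      exact P.assign_inj k k' l hk hk'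

/-- The cost of the assignment made so far. -/
def cost (I : Instance n) (P : Position n) : ℝ≥0∞ :=
  ∑ i, (P.assign i).elim 0 fun j => (I.f i : ℝ≥0∞) * (I.c j : ℝ≥0∞)

/-- There is a vacant slot as long as some item was not requested. -/
theorem exists_vacant (P : Position n) (i : Fin n) (hi : i ∉ P.requests) :
    ∃ j, ∀ k, P.assign k ≠ some j := by
  by_contra! h
  choose g hg using h
  have hinj : Function.Injective g := by
    intro a b hab
    have h1 := hg a
    rw [hab, hg b] at h1
    exact (Option.some.inj h1).symm
  obtain ⟨j, rfl⟩ := Finite.surjective_of_injective hinj i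
  exact hi ((P.assigned_iff _).1 ⟨j, hg j⟩)

end Position

/-- What an algorithm sees, apart from the instance, when it must act: the requests so far, the
assignment so far, and the next requested item, which was not requested before. -/
structure State (n : ℕ) extends Position n where
  /-- the item that needs a slot -/
  item : Fin n
  item_notMem : item ∉ requests

/-- A (randomized) algorithm: for each number `n` of items, each instance and each state, a
distribution on the vacant slots, from which the slot of the requested item is drawn. -/
def Algorithm : Type :=
  ∀ n : ℕ, Instance n → ∀ u : State n, PMF u.toPosition.Vacant

/-- First-Come-First-Served: the requested item gets the first (hence a cheapest) vacant slot, so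
the `j`-th distinct item requested gets slot `j`. -/
def fcfs : Algorithm := fun _ _ u =>
  PMF.pure ⟨Fin.find (fun j => ∀ k, u.assign k ≠ some j)
      (u.toPosition.exists_vacant u.item u.item_notMem),
    Fin.find_spec (u.toPosition.exists_vacant u.item u.item_notMem)⟩

namespace Algorithm

/-- An algorithm is online if its choice does not depend on the frequencies. -/
def IsOnline (A : Algorithm) : Prop :=
  ∀ (n : ℕ) (I I' : Instance n), I.c = I'.c → ∀ u : State n, A n I u = A n I' u

variable {n : ℕ}

/-- The law of the next position: a request is drawn from the frequencies; a new item is placed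
by the algorithm, and a repeated request changes nothing in the assignment. -/
def step (A : Algorithm) (I : Instance n) (P : Position n) : PMF (Position n) :=
  I.requestDist.bind fun i =>
    if hi : i ∈ P.requests then PMF.pure (P.again i hi)
    else (A n I ⟨P, i, hi⟩).map fun j => P.place i hi j

/-- The law of the position after `t` independent requests. -/
def play (A : Algorithm) (I : Instance n) : ℕ → PMF (Position n)
  | 0 => PMF.pure (Position.start n)
  | t + 1 => (A.play I t).bind (A.step I)

/-- The expected assignment cost. The cost of the assignment only grows along a play (and is
constant once all items have been requested), so, by monotone convergence, the expected final
cost is the supremum over `t` of the expected cost of the assignment after `t` requests. -/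
def cost (A : Algorithm) (I : Instance n) : ℝ≥0∞ :=
  ⨆ t : ℕ, ∑' P : Position n, A.play I t P * P.cost I

/-- The competitive ratio on a class of instances (of possibly varying size): the supremum of
cost divided by optimal offline cost. Here `0 / 0 = 0`, and `x / 0 = ∞` if `x > 0`. -/
def competitiveRatio (A : Algorithm) (X : ∀ n : ℕ, Set (Instance n)) : ℝ≥0∞ :=
  ⨆ (n : ℕ) (I : Instance n) (_ : I ∈ X n), A.cost I / I.opt

end Algorithm

end OSA

end

/-!
The class `X` contains all permutations of each of its instances, and these have the same optimal
cost. So the competitive ratio of an algorithm is at least its average cost over the permutations of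
an instance, divided by the optimal cost. It therefore suffices that First-Come-First-Served, whose
cost does not depend on the permutation, minimizes this average (`card_mul_fcfs_cost_le`).

Under a random permutation of the frequencies, the requests seen so far tell something about the
items requested, but the items not yet requested stay exchangeable. Of two of these the more
frequent one tends to come first (`pair_le`), hence, given any history, a new item has at least the
expected frequency of the new item after it (`sum_perm_next_le`), and by induction of every later
one (`sum_perm_arrival_antitone`). Writing each slot cost as a sum of increments, one sees that an
algorithm saves the increment at slot `l` for those items that it puts before `l`. The number of
these is bounded by the number of vacant slots there, and the items that come first are the best
ones to spend these slots on: this is what First-Come-First-Served does.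

The comparison is a dynamic programming argument. The cost of First-Come-First-Served from an
arbitrary position on has a recursive formula (`fcfs_costFrom`), and by induction on the number of
requests left, its sum over all permutations, weighted by the likelihood of the requests so far, is
a lower bound for every online algorithm (`Algorithm.sum_perm_le_costFrom`).
-/

open scoped NNReal ENNReal

namespace OSA

/-! ### New items among independent requests -/

section Arrivals

variable {ι : Type*}

/-- The unnormalized likelihood of a list of requests. -/
def likelihood (p : ι → ℝ≥0) (r : List ι) : ℝ≥0 :=
  (r.map p).prod

theorem likelihood_append_singleton (p : ι → ℝ≥0) (r : List ι) (i : ι) :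
    likelihood p (r ++ [i]) = likelihood p r * p i := by
  simp [likelihood]

variable [DecidableEq ι]

theorem likelihood_comp_swap (p : ι → ℝ≥0) {r : List ι} {i k : ι} (hi : i ∉ r) (hk : k ∉ r) :
    likelihood (fun j => p (Equiv.swap i k j)) r = likelihood p r := by
  unfold likelihood
  congr 1
  refine List.map_congr_left fun j hj => ?_
  rw [Equiv.swap_apply_of_ne_of_ne] <;> rintro rfl <;> contradiction

theorem toFinset_append_singleton (r : List ι) (i : ι) :
    (r ++ [i]).toFinset = insert i r.toFinset := by
  ext
  simp

variable [Fintype ι]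

/-- The expected total frequency of the items requested for the first time during `t` requests
drawn from `p`, when the items of `s` were requested before and the first `a` new items are not
counted. -/
def missed (p : ι → ℝ≥0) : ℕ → Finset ι → ℕ → ℝ≥0
  | 0, _, _ => 0
  | t + 1, s, a => ∑ i, p i *
      if i ∈ s then missed p t s a
      else (if a = 0 then p i else 0) + missed p t (insert i s) (a - 1)

/-- The expected frequency of the new item number `a` (counted from `0`) among `t` requests drawn
from `p`, when the items of `s` were requested before. If fewer than `a + 1` new items are
requested, this frequency counts as zero. -/
def arrival (p : ι → ℝ≥0) : ℕ → Finset ι → ℕ → ℝ≥0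
  | 0, _, _ => 0
  | t + 1, s, a => ∑ i, p i *
      if i ∈ s then arrival p t s a
      else if a = 0 then p i else arrival p t (insert i s) (a - 1)

theorem missed_eq_arrival_add (p : ι → ℝ≥0) (t : ℕ) (s : Finset ι) (a : ℕ) :
    missed p t s a = arrival p t s a + missed p t s (a + 1) := by
  induction t generalizing s a with
  | zero => simp [missed, arrival]
  | succ t ih =>
    simp only [missed, arrival]
    rw [← Finset.sum_add_distrib]
    refine Finset.sum_congr rfl fun i _ => ?_
    rw [← mul_add]
    congr 1
    by_cases hi : i ∈ s
    · simpa [hi] using ih s a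
    by_cases ha : a = 0
    · simp [hi, ha]
    · obtain ⟨b, rfl⟩ := Nat.exists_eq_succ_of_ne_zero ha
      simpa [hi] using ih (insert i s) b

theorem missed_comp_perm (p : ι → ℝ≥0) (π : Equiv.Perm ι) (t : ℕ) (s : Finset ι) (a : ℕ) :
    missed (fun i => p (π i)) t s a = missed p t (s.map π.toEmbedding) a := by
  induction t generalizing s a with
  | zero => simp [missed]
  | succ t ih =>
    simp only [missed]
    refine Fintype.sum_equiv π _ _ fun i => ?_
    simp [ih, Finset.map_insert]

/-- The next new item has, in the limit of many requests, a size-biased law on the items outside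
`s`; its expected frequency is the quotient on the right (which is `0 / 0 = 0` if no new item can
be requested). -/
theorem arrival_zero_le (p : ι → ℝ≥0) (hp : ∑ i, p i = 1) (t : ℕ) (s : Finset ι) :
    arrival p t s 0 ≤ (∑ i ∈ sᶜ, p i ^ 2) / ∑ i ∈ sᶜ, p i := by
  induction t with
  | zero => simp [arrival]
  | succ t ih =>
    have hsplit : arrival p (t + 1) s 0 =
        (∑ i ∈ s, p i) * arrival p t s 0 + ∑ i ∈ sᶜ, p i ^ 2 := by
      simp only [arrival]
      rw [← Finset.sum_add_sum_compl s, Finset.sum_mul]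
      congr 1
      · exact Finset.sum_congr rfl fun i hi => by simp [hi]
      · exact Finset.sum_congr rfl fun i hi => by simp [Finset.mem_compl.1 hi, sq]
    rw [hsplit]
    rw [← Finset.sum_add_sum_compl s] at hp
    rcases eq_or_ne (∑ i ∈ sᶜ, p i) 0 with h0 | h0
    · have hz : ∑ i ∈ sᶜ, p i ^ 2 = 0 :=
        Finset.sum_eq_zero fun i hi => by
          simp [Finset.sum_eq_zero_iff.1 h0 i hi]
      rw [hz, zero_div] at ih ⊢
      simp [nonpos_iff_eq_zero.1 ih]
    · set Q := ∑ i ∈ sᶜ, p i ^ 2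
      set T := ∑ i ∈ sᶜ, p i
      calc (∑ i ∈ s, p i) * arrival p t s 0 + Q
          ≤ (∑ i ∈ s, p i) * (Q / T) + T * (Q / T) := by
            rw [mul_div_cancel₀ Q h0]
            gcongr
        _ = Q / T := by rw [← add_mul, hp, one_mul]

/-- Among two items of frequencies `x` and `y`, with total frequency `u` of the remaining ones, the
more frequent one tends to be requested first. -/
theorem pair_le (x y u : ℝ≥0) :
    x * (y ^ 2 / (u + y)) + y * (x ^ 2 / (u + x)) ≤
      x * (x * y / (u + y)) + y * (y * x / (u + x)) := by
  rcases eq_or_ne x 0 with rfl | hx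
  · simp
  rcases eq_or_ne y 0 with rfl | hy
  · simp
  have hx' : 0 < (x : ℝ) := by positivity
  have hy' : 0 < (y : ℝ) := by positivity
  have hu : 0 ≤ (u : ℝ) := u.2
  rw [← NNReal.coe_le_coe]
  push_cast
  have key : (x : ℝ) * (x * y / (u + y)) + y * (y * x / (u + x)) -
      (x * (y ^ 2 / (u + y)) + y * (x ^ 2 / (u + x))) =
      x * y * (x - y) ^ 2 / ((u + x) * (u + y)) := by
    field_simp
    ring
  have : 0 ≤ (x : ℝ) * y * (x - y) ^ 2 / ((u + x) * (u + y)) := by positivity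
  linarith

/-- If the frequencies are permuted uniformly at random then, given any history, a new item has at
least the expected frequency of the next new one. The permutations are paired by the transposition
of the two items, to which the likelihood of the earlier history is insensitive. -/
theorem sum_perm_next_le (p : ι → ℝ≥0) (hp : ∑ i, p i = 1) (t : ℕ) {r : List ι} {i : ι}
    (hi : i ∉ r) :
    ∑ π : Equiv.Perm ι, likelihood (fun j => p (π j)) (r ++ [i]) *
        arrival (fun j => p (π j)) t (insert i r.toFinset) 0 ≤
      ∑ π : Equiv.Perm ι, likelihood (fun j => p (π j)) (r ++ [i]) * p (π i) := by
  set R := (insert i r.toFinset)ᶜ with hR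
  set w : Equiv.Perm ι → ℝ≥0 := fun π => likelihood (fun j => p (π j)) r with hw
  set T : Equiv.Perm ι → ℝ≥0 := fun π => ∑ k ∈ R, p (π k) with hT
  have hpair : ∀ k ∈ R,
      ∑ π : Equiv.Perm ι, w π * (p (π i) * (p (π k) ^ 2 / T π)) ≤
        ∑ π : Equiv.Perm ι, w π * (p (π i) * (p (π i) * p (π k) / T π)) := by
    intro k hk
    have hk' : k ≠ i ∧ k ∉ r := by simpa [hR] using hk
    -- Averaging over `π` and `π * swap i k` turns the claim into `pair_le` for each `π`.
    have hsym : ∀ F : Equiv.Perm ι → ℝ≥0,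
        2 * ∑ π, F π = ∑ π, (F π + F (π * Equiv.swap i k)) := by
      intro F
      rw [Finset.sum_add_distrib, two_mul]
      congr 1
      exact (Fintype.sum_equiv (Equiv.mulRight (Equiv.swap i k)) _ _ fun π => rfl).symm
    refine le_of_mul_le_mul_left ?_ (two_pos : (0 : ℝ≥0) < 2)
    rw [hsym, hsym]
    refine Finset.sum_le_sum fun π _ => ?_
    have hwswap : w (π * Equiv.swap i k) = w π :=
      likelihood_comp_swap (fun j => p (π j)) hi hk'.2
    have hT1 : T π = ∑ j ∈ R.erase k, p (π j) + p (π k) :=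
      (Finset.sum_erase_add R _ hk).symm
    have hT2 : T (π * Equiv.swap i k) = ∑ j ∈ R.erase k, p (π j) + p (π i) := by
      simp only [hT]
      rw [← Finset.sum_erase_add R _ hk]
      congr 1
      · refine Finset.sum_congr rfl fun j hj => ?_
        have hj' := Finset.mem_erase.1 hj
        have hji : j ≠ i := by
          rintro rfl
          simp [hR] at hj'
        simp [Equiv.swap_apply_of_ne_of_ne hji hj'.1]
      · simp
    rw [hwswap, hT2, hT1, ← mul_add, ← mul_add]
    simp only [Equiv.Perm.mul_apply, Equiv.swap_apply_left, Equiv.swap_apply_right]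
    exact mul_le_mul_right (pair_le _ _ _) _
  calc ∑ π : Equiv.Perm ι, likelihood (fun j => p (π j)) (r ++ [i]) *
        arrival (fun j => p (π j)) t (insert i r.toFinset) 0
      ≤ ∑ π : Equiv.Perm ι, ∑ k ∈ R, w π * (p (π i) * (p (π k) ^ 2 / T π)) := by
        refine Finset.sum_le_sum fun π _ => ?_
        rw [likelihood_append_singleton, ← Finset.mul_sum, ← Finset.mul_sum, ← Finset.sum_div,
          mul_assoc]
        gcongr
        exact arrival_zero_le _ ((Equiv.sum_comp π p).trans hp) t _
    _ ≤ ∑ π : Equiv.Perm ι, ∑ k ∈ R, w π * (p (π i) * (p (π i) * p (π k) / T π)) := by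
        rw [Finset.sum_comm, Finset.sum_comm (s := Finset.univ)]
        exact Finset.sum_le_sum hpair
    _ ≤ _ := by
        refine Finset.sum_le_sum fun π _ => ?_
        rw [likelihood_append_singleton, ← Finset.mul_sum, ← Finset.mul_sum, ← Finset.sum_div,
          ← Finset.mul_sum, mul_assoc, mul_div_assoc]
        gcongr
        -- The quotient is `1`, except that it is `0` if no new item but `i` can be requested.
        exact mul_le_of_le_one_right' (div_self_le_one _)

/-- Splitting off the next request from a sum over the permutations of the frequencies. -/
theorem sum_perm_arrival_succ (p : ι → ℝ≥0) (t : ℕ) (r : List ι) (a : ℕ) :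
    ∑ π : Equiv.Perm ι, likelihood (fun j => p (π j)) r *
        arrival (fun j => p (π j)) (t + 1) r.toFinset a =
      ∑ i, ∑ π : Equiv.Perm ι, likelihood (fun j => p (π j)) (r ++ [i]) *
        if i ∈ r.toFinset then arrival (fun j => p (π j)) t r.toFinset a
        else if a = 0 then p (π i)
        else arrival (fun j => p (π j)) t (insert i r.toFinset) (a - 1) := by
  rw [Finset.sum_comm]
  refine Finset.sum_congr rfl fun π _ => ?_
  simp only [arrival, Finset.mul_sum, likelihood_append_singleton, mul_assoc]

/-- If the frequencies are permuted uniformly at random then, given any history, the expected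
frequencies of the successive new items decrease. -/
theorem sum_perm_arrival_antitone (p : ι → ℝ≥0) (hp : ∑ i, p i = 1) (t : ℕ) (r : List ι) :
    Antitone fun a => ∑ π : Equiv.Perm ι, likelihood (fun j => p (π j)) r *
      arrival (fun j => p (π j)) t r.toFinset a := by
  refine antitone_nat_of_succ_le fun a => ?_
  induction t generalizing r a with
  | zero => simp [arrival]
  | succ t ih =>
    rw [sum_perm_arrival_succ, sum_perm_arrival_succ]
    refine Finset.sum_le_sum fun i _ => ?_
    by_cases hi : i ∈ r.toFinset
    · have h := ih (r ++ [i]) a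
      rw [toFinset_append_singleton, Finset.insert_eq_of_mem hi] at h
      simpa only [hi, if_true] using h
    · simp only [hi, if_false, Nat.add_eq_zero_iff, one_ne_zero, and_false, add_tsub_cancel_right]
      rcases a with _ | a
      · simpa using sum_perm_next_le p hp t (by simpa using hi)
      · have h := ih (r ++ [i]) a
        rw [toFinset_append_singleton] at h
        simpa using h

/-- The exchange inequality: when the new item `i` is requested, paying for it in order to skip
`a + 1` instead of `a` of the later new items does not lower the expected total. -/
theorem sum_perm_missed_le (p : ι → ℝ≥0) (hp : ∑ i, p i = 1) (t : ℕ) {r : List ι} {i : ι}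
    (hi : i ∉ r) (a : ℕ) :
    ∑ π : Equiv.Perm ι, likelihood (fun j => p (π j)) (r ++ [i]) *
        missed (fun j => p (π j)) t (insert i r.toFinset) a ≤
      ∑ π : Equiv.Perm ι, likelihood (fun j => p (π j)) (r ++ [i]) *
        (p (π i) + missed (fun j => p (π j)) t (insert i r.toFinset) (a + 1)) := by
  simp only [missed_eq_arrival_add _ t _ a, mul_add, Finset.sum_add_distrib]
  gcongr ?_ + _
  refine le_trans ?_ (sum_perm_next_le p hp t hi)
  have h := sum_perm_arrival_antitone p hp t (r ++ [i]) (Nat.zero_le a)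
  rwa [toFinset_append_singleton] at h

end Arrivals

/-! ### Expectations under a `PMF` -/

theorem tsum_bind_mul {α β : Type*} (q : PMF α) (k : α → PMF β) (g : β → ℝ≥0∞) :
    ∑' b, q.bind k b * g b = ∑' a, q a * ∑' b, k a b * g b := by
  simp only [PMF.bind_apply, ← ENNReal.tsum_mul_right, ← ENNReal.tsum_mul_left, mul_assoc]
  exact ENNReal.tsum_comm

theorem tsum_pure_mul {α : Type*} (a : α) (g : α → ℝ≥0∞) :
    ∑' b, PMF.pure a b * g b = g a := by
  rw [tsum_eq_single a]
  · simp
  · intro b hb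
    simp [PMF.pure_apply, hb]

theorem tsum_map_mul {α β : Type*} (q : PMF α) (h : α → β) (g : β → ℝ≥0∞) :
    ∑' b, q.map h b * g b = ∑' a, q a * g (h a) := by
  rw [← PMF.bind_pure_comp, tsum_bind_mul]
  simp only [Function.comp_apply, tsum_pure_mul]

/-! ### Normalized frequencies and cost increments -/

namespace Instance

variable {n : ℕ} (I : Instance n)

/-- The sum of the frequencies. -/
noncomputable def total : ℝ≥0 := ∑ i, I.f i

/-- The normalized frequency vector. -/
noncomputable def freq (i : Fin n) : ℝ≥0 := I.f i / I.total

theorem total_ne_zero : I.total ≠ 0 := by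
  intro h
  apply I.f_ne_zero
  funext i
  exact Finset.sum_eq_zero_iff.1 h i (Finset.mem_univ i)

theorem sum_freq : ∑ i, I.freq i = 1 := by
  unfold freq
  rw [← Finset.sum_div]
  exact div_self I.total_ne_zero

theorem total_mul_freq (i : Fin n) : I.total * I.freq i = I.f i :=
  mul_div_cancel₀ _ I.total_ne_zero

theorem requestDist_apply (i : Fin n) : I.requestDist i = I.freq i := by
  rw [requestDist, PMF.normalize_apply, tsum_fintype, freq, ENNReal.coe_div I.total_ne_zero,
    total, ENNReal.ofNNReal_finsetSum, div_eq_mul_inv]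

theorem total_permute (π : Equiv.Perm (Fin n)) : (I.permute π).total = I.total :=
  Equiv.sum_comp π I.f

theorem freq_permute (π : Equiv.Perm (Fin n)) :
    (I.permute π).freq = fun i => I.freq (π i) := by
  funext i
  simp only [freq, total_permute]
  rfl

theorem opt_permute (π : Equiv.Perm (Fin n)) : (I.permute π).opt = I.opt := by
  unfold opt
  refine Equiv.iInf_congr (Equiv.mulRight π⁻¹) fun σ => ?_
  refine (Equiv.sum_comp π _).symm.trans (Finset.sum_congr rfl fun i _ => ?_)
  simp [permute]

/-- The cost of slot `l` in excess of the cost of the slot before it; for the first slot, its whole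
cost. -/
noncomputable def increment (l : Fin n) : ℝ≥0 :=
  if h : l.1 = 0 then I.c l else I.c l - I.c ⟨l.1 - 1, by omega⟩

theorem sum_increment (j : Fin n) : ∑ l, (if l ≤ j then I.increment l else 0) = I.c j := by
  obtain ⟨j, hj⟩ := j
  induction j with
  | zero =>
    rw [Finset.sum_eq_single_of_mem ⟨0, hj⟩ (Finset.mem_univ _)]
    · simp [increment]
    · intro l _ hl
      rw [if_neg]
      intro h
      exact hl (Fin.ext (Nat.le_zero.1 h))
  | succ j ih =>
    have hstep : ∀ l : Fin n, (if l ≤ ⟨j + 1, hj⟩ then I.increment l else 0) =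
        (if l ≤ ⟨j, by omega⟩ then I.increment l else 0) +
          if l = ⟨j + 1, hj⟩ then I.increment l else 0 := by
      intro l
      simp only [Fin.le_def, Fin.ext_iff]
      rcases lt_trichotomy l.1 (j + 1) with h | h | h
      · simp [h.le, Nat.le_of_lt_succ h, h.ne]
      · simp [h]
      · simp [h.not_ge, (Nat.lt_of_succ_lt h).not_ge, h.ne']
    rw [Finset.sum_congr rfl fun l _ => hstep l, Finset.sum_add_distrib, ih (by omega)]
    simp only [Finset.sum_ite_eq', Finset.mem_univ, if_true]
    simp only [increment, Nat.add_eq_zero_iff, one_ne_zero, and_false, dite_false,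
      add_tsub_cancel_right]
    exact add_tsub_cancel_of_le (I.c_mono (by simp [Fin.le_def]))

end Instance

/-! ### Vacant slots -/

namespace Position

variable {n : ℕ}

/-- The number of vacant slots before slot `l`. -/
def vacantBelow (P : Position n) (l : Fin n) : ℕ :=
  (Finset.univ.filter fun j => j < l ∧ ∀ k, P.assign k ≠ some j).card

theorem assign_eq_none (P : Position n) {i : Fin n} (hi : i ∉ P.requests) :
    P.assign i = none := by
  rw [← P.assigned_iff] at hi
  exact Option.eq_none_iff_forall_ne_some.2 fun j h => hi ⟨j, h⟩

theorem vacantBelow_place (P : Position n) (i : Fin n) (hi : i ∉ P.requests) (j : P.Vacant)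
    (l : Fin n) :
    (P.place i hi j).vacantBelow l = if j.1 < l then P.vacantBelow l - 1 else P.vacantBelow l := by
  have h : (Finset.univ.filter fun m => m < l ∧ ∀ k, (P.place i hi j).assign k ≠ some m) =
      (Finset.univ.filter fun m => m < l ∧ ∀ k, P.assign k ≠ some m).erase j.1 := by
    ext m
    rw [Finset.mem_erase, Finset.mem_filter, Finset.mem_filter]
    simp only [Finset.mem_univ, true_and, place]
    constructor
    · rintro ⟨hm, h⟩
      refine ⟨fun hmj => h i (by simp [hmj]), hm, fun k hk => ?_⟩
      rcases eq_or_ne k i with rfl | hki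
      · simp [P.assign_eq_none hi] at hk
      · exact h k (by rwa [Function.update_of_ne hki])
    · rintro ⟨hmj, hm, h⟩
      refine ⟨hm, fun k hk => ?_⟩
      rcases eq_or_ne k i with rfl | hki
      · rw [Function.update_self] at hk
        exact hmj (Option.some.inj hk).symm
      · rw [Function.update_of_ne hki] at hk
        exact h k hk
  unfold vacantBelow
  rw [h, Finset.card_erase_eq_ite]
  simp [j.2]

theorem vacantBelow_pos (P : Position n) (j : P.Vacant) {l : Fin n} (h : j.1 < l) :
    0 < P.vacantBelow l :=
  Finset.card_pos.2 ⟨j.1, by simp [h, j.2]⟩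

theorem cost_place (I : Instance n) (P : Position n) (i : Fin n) (hi : i ∉ P.requests)
    (j : P.Vacant) :
    (P.place i hi j).cost I = P.cost I + (I.f i : ℝ≥0∞) * (I.c j.1 : ℝ≥0∞) := by
  unfold cost
  rw [← Finset.add_sum_erase _ _ (Finset.mem_univ i),
    ← Finset.add_sum_erase (a := i) (f := fun k => (P.assign k).elim 0 fun m =>
      (I.f k : ℝ≥0∞) * (I.c m : ℝ≥0∞)) _ (Finset.mem_univ i),
    P.assign_eq_none hi, add_comm]
  simp only [place, Function.update_self, Option.elim_some, Option.elim_none, zero_add]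
  congr 1
  refine Finset.sum_congr rfl fun k hk => ?_
  rw [Function.update_of_ne (Finset.ne_of_mem_erase hk)]

theorem cost_again (I : Instance n) (P : Position n) (i : Fin n) (hi : i ∈ P.requests) :
    (P.again i hi).cost I = P.cost I := rfl

theorem vacantBelow_again (P : Position n) (i : Fin n) (hi : i ∈ P.requests) (l : Fin n) :
    (P.again i hi).vacantBelow l = P.vacantBelow l := rfl

end Position

/-! ### The cost of First-Come-First-Served and the exchange of slots -/

/-- The expected cost of the placements that First-Come-First-Served makes during `t` requests
from the position `P` on. Slot costs are split into their increments: the increment at `l` is paid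
for all new items but those that fit into the vacant slots before `l`. -/
noncomputable def fcfsFutureCost {n : ℕ} (I : Instance n) (t : ℕ) (P : Position n) : ℝ≥0 :=
  ∑ l, I.total * I.increment l * missed I.freq t P.requests.toFinset (P.vacantBelow l)

variable {n : ℕ}

/-- The part of `fcfsFutureCost I (t + 1) P` that arises when the next request is for `i`. -/
noncomputable def fcfsRequestCost (I : Instance n) (t : ℕ) (P : Position n) (i : Fin n) : ℝ≥0 :=
  ∑ l, I.total * I.increment l *
    if i ∈ P.requests.toFinset then missed I.freq t P.requests.toFinset (P.vacantBelow l)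
    else (if P.vacantBelow l = 0 then I.freq i else 0) +
      missed I.freq t (insert i P.requests.toFinset) (P.vacantBelow l - 1)

theorem fcfsFutureCost_succ (I : Instance n) (t : ℕ) (P : Position n) :
    fcfsFutureCost I (t + 1) P = ∑ i, I.freq i * fcfsRequestCost I t P i := by
  simp only [fcfsFutureCost, fcfsRequestCost, missed, Finset.mul_sum]
  rw [Finset.sum_comm]
  exact Finset.sum_congr rfl fun i _ => Finset.sum_congr rfl fun l _ => by ring

theorem fcfsFutureCost_again (I : Instance n) (t : ℕ) (P : Position n) (i : Fin n)
    (hi : i ∈ P.requests) :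
    fcfsFutureCost I t (P.again i hi) = fcfsRequestCost I t P i := by
  have hi' : i ∈ P.requests.toFinset := by simpa using hi
  have : (P.again i hi).requests.toFinset = P.requests.toFinset := by
    rw [← Finset.insert_eq_of_mem hi']
    exact toFinset_append_singleton _ _
  simp only [fcfsFutureCost, fcfsRequestCost, this, hi', if_true, P.vacantBelow_again]

/-- The cost of the slot `j` for a new item, together with the later cost of
First-Come-First-Served, by increments. -/
theorem mul_add_fcfsFutureCost_place (I : Instance n) (t : ℕ) (P : Position n) (i : Fin n)
    (hi : i ∉ P.requests) (j : P.Vacant) :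
    I.f i * I.c j.1 + fcfsFutureCost I t (P.place i hi j) =
      ∑ l, I.total * I.increment l *
        if j.1 < l then missed I.freq t (insert i P.requests.toFinset) (P.vacantBelow l - 1)
        else I.freq i + missed I.freq t (insert i P.requests.toFinset) (P.vacantBelow l) := by
  have hreq : (P.place i hi j).requests.toFinset = insert i P.requests.toFinset :=
    toFinset_append_singleton _ _
  rw [← I.sum_increment, ← I.total_mul_freq, Finset.mul_sum, fcfsFutureCost,
    ← Finset.sum_add_distrib]
  refine Finset.sum_congr rfl fun l _ => ?_
  rw [hreq, P.vacantBelow_place]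
  by_cases h : j.1 < l
  · simp [h, h.not_ge]
  · simp only [h, not_lt.1 h, if_true, if_false]
    ring

/-- First-Come-First-Served pays the increment at `l` just when no slot before `l` is vacant. -/
theorem fcfsFutureCost_place_first (I : Instance n) (t : ℕ) (P : Position n) (i : Fin n)
    (hi : i ∉ P.requests) (j : P.Vacant) (hj : ∀ m, (∀ k, P.assign k ≠ some m) → j.1 ≤ m) :
    I.f i * I.c j.1 + fcfsFutureCost I t (P.place i hi j) = fcfsRequestCost I t P i := by
  have hi' : i ∉ P.requests.toFinset := by simpa using hi
  rw [mul_add_fcfsFutureCost_place, fcfsRequestCost]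
  refine Finset.sum_congr rfl fun l _ => ?_
  rw [if_neg hi']
  by_cases h : j.1 < l
  · simp [h, (P.vacantBelow_pos j h).ne']
  · have h0 : P.vacantBelow l = 0 := by
      refine Finset.card_eq_zero.2 (Finset.filter_eq_empty_iff.2 ?_)
      rintro m - ⟨hm, hvac⟩
      exact h ((hj m hvac).trans_lt hm)
    simp [h, h0]

/-- On average over the permutations of the frequencies, putting a new item in any vacant slot and
going on with First-Come-First-Served is no better than following it at once. -/
theorem sum_perm_fcfsRequestCost_le (I : Instance n) (t : ℕ) (P : Position n) (i : Fin n)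
    (hi : i ∉ P.requests) (j : P.Vacant) :
    ∑ π : Equiv.Perm (Fin n), likelihood (I.permute π).freq (P.requests ++ [i]) *
        fcfsRequestCost (I.permute π) t P i ≤
      ∑ π : Equiv.Perm (Fin n), likelihood (I.permute π).freq (P.requests ++ [i]) *
        ((I.permute π).f i * (I.permute π).c j.1 +
          fcfsFutureCost (I.permute π) t (P.place i hi j)) := by
  have hi' : i ∉ P.requests.toFinset := by simpa using hi
  have hinc : ∀ π : Equiv.Perm (Fin n), (I.permute π).increment = I.increment := fun _ => rfl
  simp only [mul_add_fcfsFutureCost_place, fcfsRequestCost, hi', if_false, Finset.mul_sum,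
    I.total_permute, I.freq_permute, hinc]
  rw [Finset.sum_comm, Finset.sum_comm (s := Finset.univ (α := Equiv.Perm (Fin n)))]
  refine Finset.sum_le_sum fun l _ => ?_
  simp only [mul_left_comm _ (I.total * I.increment l)]
  rw [← Finset.mul_sum, ← Finset.mul_sum]
  gcongr (I.total * I.increment l) * ?_
  by_cases h : j.1 < l
  · simp [h, (P.vacantBelow_pos j h).ne']
  · simp only [h, if_false]
    rcases hv : P.vacantBelow l with _ | b
    · simp
    · have hle := sum_perm_missed_le I.freq I.sum_freq t hi b
      simpa using hle

/-! ### Dynamic programming -/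

namespace Algorithm

/-- The expected cost of the whole assignment after `t` more requests from a given position. -/
noncomputable def costFrom (A : Algorithm) (I : Instance n) : ℕ → Position n → ℝ≥0∞
  | 0, P => P.cost I
  | t + 1, P => ∑' Q, A.step I P Q * A.costFrom I t Q

theorem costFrom_succ (A : Algorithm) (I : Instance n) (t : ℕ) (P : Position n) :
    A.costFrom I (t + 1) P = ∑ i, (I.freq i : ℝ≥0∞) *
      if hi : i ∈ P.requests then A.costFrom I t (P.again i hi)
      else ∑' j, A n I ⟨P, i, hi⟩ j * A.costFrom I t (P.place i hi j) := by
  rw [costFrom, step, tsum_bind_mul, tsum_fintype]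
  refine Finset.sum_congr rfl fun i _ => ?_
  rw [I.requestDist_apply]
  split_ifs with hi
  · rw [tsum_pure_mul]
  · rw [tsum_map_mul]

/-- The law `play` is defined forwards and `costFrom` backwards in time; the two meet anywhere. -/
theorem tsum_play_mul_costFrom (A : Algorithm) (I : Instance n) (t s : ℕ) :
    ∑' P, A.play I t P * A.costFrom I s P = A.costFrom I (t + s) (Position.start n) := by
  induction t generalizing s with
  | zero => rw [play, tsum_pure_mul, zero_add]
  | succ t ih =>
    rw [play, tsum_bind_mul, Nat.succ_add_eq_add_succ, ← ih (s + 1)]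
    rfl

theorem cost_eq_iSup (A : Algorithm) (I : Instance n) :
    A.cost I = ⨆ t, A.costFrom I t (Position.start n) :=
  iSup_congr fun t => A.tsum_play_mul_costFrom I t 0

/-- On average over the permutations of the frequencies, weighted by the likelihood of the requests
so far, no online algorithm does better from a position on than First-Come-First-Served. -/
theorem sum_perm_le_costFrom {A : Algorithm} (hA : A.IsOnline) (I : Instance n) (t : ℕ)
    (P : Position n) :
    ∑ π : Equiv.Perm (Fin n), (likelihood (I.permute π).freq P.requests : ℝ≥0∞) *
        (P.cost (I.permute π) + fcfsFutureCost (I.permute π) t P) ≤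
      ∑ π : Equiv.Perm (Fin n), (likelihood (I.permute π).freq P.requests : ℝ≥0∞) *
        A.costFrom (I.permute π) t P := by
  induction t generalizing P with
  | zero => simp [costFrom, fcfsFutureCost, missed]
  | succ t ih =>
    have hsplit : ∀ (π : Equiv.Perm (Fin n)) (g : Fin n → ℝ≥0∞),
        (likelihood (I.permute π).freq P.requests : ℝ≥0∞) *
            ∑ i, ((I.permute π).freq i : ℝ≥0∞) * g i =
          ∑ i, (likelihood (I.permute π).freq (P.requests ++ [i]) : ℝ≥0∞) * g i := by
      intro π g
      rw [Finset.mul_sum]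
      refine Finset.sum_congr rfl fun i _ => ?_
      rw [likelihood_append_singleton, ENNReal.coe_mul, mul_assoc]
    have hleft : ∀ π : Equiv.Perm (Fin n),
        P.cost (I.permute π) + (fcfsFutureCost (I.permute π) (t + 1) P : ℝ≥0∞) =
          ∑ i, ((I.permute π).freq i : ℝ≥0∞) *
            (P.cost (I.permute π) + fcfsRequestCost (I.permute π) t P i) := by
      intro π
      simp only [mul_add, Finset.sum_add_distrib]
      rw [← Finset.sum_mul, ← ENNReal.ofNNReal_finsetSum, Instance.sum_freq, fcfsFutureCost_succ]
      simp
    simp only [hleft, costFrom_succ, hsplit]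
    rw [Finset.sum_comm, Finset.sum_comm (s := Finset.univ (α := Equiv.Perm (Fin n)))]
    refine Finset.sum_le_sum fun i _ => ?_
    by_cases hi : i ∈ P.requests
    · have h := ih (P.again i hi)
      simp only [fcfsFutureCost_again, P.cost_again] at h
      simp only [hi, dite_true]
      exact h
    · -- The slot is drawn from the same law for all `π`, so it suffices to compare for each slot.
      have hblind : ∀ π : Equiv.Perm (Fin n),
          A n (I.permute π) ⟨P, i, hi⟩ = A n I ⟨P, i, hi⟩ := fun π => hA n (I.permute π) I rfl _
      simp only [hi, dite_false, hblind, ← ENNReal.tsum_mul_left]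
      rw [← Summable.tsum_finsetSum fun _ _ => ENNReal.summable]
      simp only [mul_left_comm _ (A n I ⟨P, i, hi⟩ _), ← Finset.mul_sum]
      rw [← one_mul (∑ π : Equiv.Perm (Fin n), _), ← (A n I ⟨P, i, hi⟩).tsum_coe,
        ← ENNReal.tsum_mul_right]
      refine ENNReal.tsum_le_tsum fun j => ?_
      gcongr _ * ?_
      refine le_trans ?_ (ih (P.place i hi j))
      simp only [P.cost_place, add_assoc, mul_add (_ : ℝ≥0∞) (P.cost _), Finset.sum_add_distrib]
      gcongr _ + ?_
      exact_mod_cast sum_perm_fcfsRequestCost_le I t P i hi j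

end Algorithm

/-- From an arbitrary position on, First-Come-First-Served has the cost given by
`fcfsFutureCost`. -/
theorem fcfs_costFrom (I : Instance n) (t : ℕ) (P : Position n) :
    fcfs.costFrom I t P = P.cost I + fcfsFutureCost I t P := by
  induction t generalizing P with
  | zero => simp [Algorithm.costFrom, fcfsFutureCost, missed]
  | succ t ih =>
    have hterm : ∀ i, (if hi : i ∈ P.requests then fcfs.costFrom I t (P.again i hi)
        else ∑' j, fcfs n I ⟨P, i, hi⟩ j * fcfs.costFrom I t (P.place i hi j)) =
          P.cost I + fcfsRequestCost I t P i := by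
      intro i
      split_ifs with hi
      · rw [ih, fcfsFutureCost_again, P.cost_again]
      · rw [fcfs, tsum_pure_mul, ih, P.cost_place, add_assoc, ← ENNReal.coe_mul, ← ENNReal.coe_add,
          fcfsFutureCost_place_first]
        exact fun m hm => Fin.find_le_of_pos _ hm
    simp only [Algorithm.costFrom_succ, hterm, mul_add, Finset.sum_add_distrib]
    rw [← Finset.sum_mul, ← ENNReal.ofNNReal_finsetSum, I.sum_freq, fcfsFutureCost_succ]
    simp

theorem cost_start (I : Instance n) : (Position.start n).cost I = 0 := by
  simp [Position.cost, Position.start]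

theorem fcfsFutureCost_start_permute (I : Instance n) (π : Equiv.Perm (Fin n)) (t : ℕ) :
    fcfsFutureCost (I.permute π) t (Position.start n) =
      fcfsFutureCost I t (Position.start n) := by
  refine Finset.sum_congr rfl fun l _ => ?_
  rw [I.total_permute, I.freq_permute, missed_comp_perm]
  rfl

/-- The cost of First-Come-First-Served is at most the average cost of an online algorithm over the
permutations of the frequencies. -/
theorem card_mul_fcfs_cost_le {A : Algorithm} (hA : A.IsOnline) (I : Instance n) :
    (Fintype.card (Equiv.Perm (Fin n)) : ℝ≥0∞) * fcfs.cost I ≤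
      ∑ π : Equiv.Perm (Fin n), A.cost (I.permute π) := by
  rw [fcfs.cost_eq_iSup, ENNReal.mul_iSup]
  refine iSup_le fun t => ?_
  have h := Algorithm.sum_perm_le_costFrom hA I t (Position.start n)
  have hw : ∀ p : Fin n → ℝ≥0, likelihood p (Position.start n).requests = 1 := fun _ => rfl
  simp only [hw, ENNReal.coe_one, one_mul, fcfsFutureCost_start_permute, cost_start] at h
  calc _ = ∑ π : Equiv.Perm (Fin n), fcfs.costFrom I t (Position.start n) := by simp
    _ = _ := by rw [fcfs_costFrom, cost_start]
    _ ≤ _ := h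
    _ ≤ _ := Finset.sum_le_sum fun π _ => by
      rw [A.cost_eq_iSup]
      exact le_iSup (fun t => A.costFrom (I.permute π) t (Position.start n)) t

end OSA

theorem theorem1 (X : ∀ n : ℕ, Set (OSA.Instance n))
    (hX : ∀ (n : ℕ) (I : OSA.Instance n), I ∈ X n →
      ∀ π : Equiv.Perm (Fin n), I.permute π ∈ X n) :
    OSA.fcfs.IsOnline ∧
      ∀ A : OSA.Algorithm, A.IsOnline →
        OSA.fcfs.competitiveRatio X ≤ A.competitiveRatio X := by
  refine ⟨fun n I I' _ u => rfl, fun A hA => ?_⟩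
  refine iSup_le fun n => iSup_le fun I => iSup_le fun hI => ?_
  have hN : (Fintype.card (Equiv.Perm (Fin n)) : ℝ≥0∞) ≠ 0 := by
    exact_mod_cast Fintype.card_ne_zero
  refine (ENNReal.mul_le_mul_iff_right hN (ENNReal.natCast_ne_top _)).1 ?_
  calc (Fintype.card (Equiv.Perm (Fin n)) : ℝ≥0∞) * (OSA.fcfs.cost I / I.opt)
      ≤ (∑ π : Equiv.Perm (Fin n), A.cost (I.permute π)) / I.opt := by
        rw [← mul_div_assoc]
        exact ENNReal.div_le_div_right (OSA.card_mul_fcfs_cost_le hA I) _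
    _ = ∑ π : Equiv.Perm (Fin n), A.cost (I.permute π) / (I.permute π).opt := by
        simp only [I.opt_permute, div_eq_mul_inv, Finset.sum_mul]
    _ ≤ ∑ _π : Equiv.Perm (Fin n), A.competitiveRatio X :=
        Finset.sum_le_sum fun π _ =>
          le_iSup_of_le n (le_iSup_of_le (I.permute π) (le_iSup_of_le (hX n I hI π) le_rfl))
    _ = _ := by simp
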